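/- Let $\mathbb{K}=\mathbb{R}$ or $\mathbb{C}$. For a normed space $X$ over $\mathbb{K}$, let $\mathcal{L}^s({}^mX;\mathbb{K})$ be the space of continuous symmetric $m$-linear forms $L:X^m\to\mathbb{K}$, with $\|L\|=\sup\{|L(x_1,\dots,x_m)|:\|x_i\|\le 1\}$, and for such $L$ put $\widehat{L}(x)=L(x,\dots,x)$ and $\|\widehat L\|=\sup\{|\widehat L(x)|:\|x\|\le 1\}$. The $m$-th polarization constant of $X$ is $$\mathbb{K}(m,X)=\inf\{M>0:\ \|L\|\le M\|\widehat L\|\ \text{ for all } L\in\mathcal{L}^s({}^mX;\mathbb{K})\},$$ and for $1\le p\le\infty$ let $\mathbb{K}(m,p)=\sup\{\mathbb{K}(m,L_p(\mu)):\mu \text{ a measure}\}$, where $L_p(\mu)$ is the space of $\mathbb{K}$-valued functions (written $\mathbb{C}(m,p)$ when $\mathbb{K}=\mathbb{C}$). Denote by $p'$ and $m'=m/(m-1)$ the conjugate exponents of $p$ and $m$. Then, for every integer $m\ge 2$ and both for $\mathbb{K}=\mathbb{R}$ and for $\mathbb{K}=\mathbb{C}$, $$\mathbb{K}(m,p)\le\begin{cases}\dfrac{m^{m/p}}{m!},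 & 1\le p\le m',\\[2mm] \dfrac{m^{m-1}}{m!}, & m'\le p\le m,\\[2mm] \dfrac{m^{m/p'}}{m!}, & m\le p\le\infty.\end{cases}$$ Moreover, $\mathbb{K}(m,p)=\dfrac{m^{m/p}}{m!}$ for $1\le p\le m'$. Consequently, if $m\ge 3$ and $1<p\le m'$, then $$\mathbb{K}(m,p)<\left(\frac{m^m}{m!}\right)^{|p-2|/p},$$ so the value $\mathbb{C}(m,p)=(m^m/m!)^{|p-2|/p}$ conjectured by Harris is not correct for any $m\ge 3$ and $1<p\le m'$. -/

import Mathlib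

open MeasureTheory
open scoped ENNReal NNReal Nat

universe u

namespace Polarization

section Normed

variable {𝕜 : Type*} [RCLike 𝕜] {E : Type*} [NormedAddCommGroup E] [NormedSpace 𝕜 E] {m : ℕ}

/-- A continuous `m`-linear form is symmetric if its values do not change when its arguments
are permuted. -/
def IsSymmetricForm (L : ContinuousMultilinearMap 𝕜 (fun _ : Fin m => E) 𝕜) : Prop :=
  ∀ (σ : Equiv.Perm (Fin m)) (x : Fin m → E), L (fun i => x (σ i)) = L x

/-- The norm `sup {|L(x, …, x)| : ‖x‖ ≤ 1}` of the `m`-homogeneous polynomial `x ↦ L(x, …, x)`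
associated with a continuous `m`-linear form `L`. -/
noncomputable def polyNorm (L : ContinuousMultilinearMap 𝕜 (fun _ : Fin m => E) 𝕜) : ℝ :=
  sSup {r : ℝ | ∃ x : E, ‖x‖ ≤ 1 ∧ r = ‖L (fun _ => x)‖}

/-- The supremum in `polyNorm` is taken over a bounded set (which contains `‖L(0, …, 0)‖`). -/
theorem bddAbove_polyNorm (L : ContinuousMultilinearMap 𝕜 (fun _ : Fin m => E) 𝕜) :
    BddAbove {r : ℝ | ∃ x : E, ‖x‖ ≤ 1 ∧ r = ‖L (fun _ => x)‖} := by
  refine ⟨‖L‖, ?_⟩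
  rintro r ⟨x, hx, rfl⟩
  refine (L.le_opNorm _).trans ?_
  have h : ∏ _i : Fin m, ‖x‖ ≤ 1 :=
    Finset.prod_le_one (fun _ _ => norm_nonneg x) (fun _ _ => hx)
  exact mul_le_of_le_one_right (norm_nonneg L) h

end Normed

/-- The `m`-th polarization constant of a normed space `E` over `𝕜`: the infimum of all
`M > 0` such that `‖L‖ ≤ M ‖L̂‖` for every continuous symmetric `m`-linear form `L` on `E`,
where `L̂(x) = L(x, …, x)`.  It takes values in `[0, ∞]`, and an infimum over
no `M` at all would be `∞`. -/
noncomputable def polarizationConstant (𝕜 : Type*) [RCLike 𝕜] (m : ℕ)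
    (E : Type*) [NormedAddCommGroup E] [NormedSpace 𝕜 E] : ℝ≥0∞ :=
  ⨅ (M : ℝ≥0) (_ : 0 < M)
    (_ : ∀ L : ContinuousMultilinearMap 𝕜 (fun _ : Fin m => E) 𝕜,
      IsSymmetricForm L → ‖L‖ ≤ (M : ℝ) * polyNorm L), (M : ℝ≥0∞)

/-- `𝕂(m, p)`: the supremum of the `m`-th polarization constants of the spaces `L_p(μ)` of
`𝕜`-valued functions, over all measures `μ` on all measurable spaces `Ω` (in a universe `u`). -/
noncomputable def polarizationConstantLp (𝕜 : Type*) [RCLike 𝕜] (m : ℕ)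
    (p : ℝ≥0∞) [Fact (1 ≤ p)] : ℝ≥0∞ :=
  ⨆ (Ω : Type u) (_ : MeasurableSpace Ω) (μ : Measure Ω),
    polarizationConstant 𝕜 m (Lp 𝕜 p μ)

end Polarization

namespace Polarization

/-! ### Rademacher sums of scalars: Hausdorff–Young by complex interpolation. -/

section Scalar

open Complex HadamardThreeLines

/-! Averaging `∏ εᵢ · L̂(∑ εᵢ xᵢ)` over all signs gives `m! L(x)`, so the polarization constant is
at most the largest `m`-th moment of `‖∑ εᵢ xᵢ‖` over unit-ball vectors, divided by `m!`
(`polarizationConstant_le_of_sum_signs`). By Jensen the `q`-th moment may be used for any `q ≥ m`.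

In `L_p`, with `r = q' ≤ p ≤ q`, that moment is at most `m^(q-1)` (`sum_signs_norm_Lp_rpow_le`):
pointwise this is Hausdorff–Young for the sign matrix, interpolated between `ℓ¹ → ℓ^∞` and `ℓ² →
ℓ²`, and Minkowski's inequality carries it into `L_p`. The outcome is the bound `m^(m/r)/m!`. The
three ranges come from `r = p`, `r = m'` and `r = p'`; for `p = 1` and `p = ∞` the triangle
inequality suffices.

For sharpness when `p ≤ m'`, the permanent on `ℓ_p^m` is `1` at the unit vectors, while its
polynomial `m! x₁⋯x_m` has norm at most `m!/m^(m/p)` by AM–GM. The comparison with Harris's value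
reduces to `m^m < (m!)²`. -/

theorem sum_signs_prod_pow {ι R : Type*} [Fintype ι] [DecidableEq ι] [CommRing R] (k : ι → ℕ) :
    ∑ ε : ι → ℤˣ, ∏ i, ((ε i : ℤ) : R) ^ k i =
      if ∀ i, Even (k i) then 2 ^ Fintype.card ι else 0 := by
  have h1 : ∀ n : ℕ, ∑ s : ℤˣ, ((s : ℤ) : R) ^ n = if Even n then 2 else 0 := by
    intro n
    have hu : (Finset.univ : Finset ℤˣ) = {1, -1} := by decide
    rw [hu, Finset.sum_pair (by decide)]
    rcases Nat.even_or_odd n with h | h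
    · simp [h, h.neg_one_pow]; norm_num
    · simp [h.neg_one_pow, Nat.not_even_iff_odd.2 h]
  have h2 := Finset.prod_univ_sum (fun _ : ι => (Finset.univ : Finset ℤˣ))
    (fun i s => ((s : ℤ) : R) ^ k i)
  rw [Fintype.piFinset_univ] at h2
  rw [← h2]
  simp_rw [h1]
  split_ifs with h
  · simp [h]
  · push Not at h
    obtain ⟨i, hi⟩ := h
    exact Finset.prod_eq_zero (Finset.mem_univ i) (by simp [hi])

theorem sum_signs_mul {ι R : Type*} [Fintype ι] [DecidableEq ι] [CommRing R] (i j : ι) :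
    ∑ ε : ι → ℤˣ, ((ε i : ℤ) : R) * ((ε j : ℤ) : R) =
      if i = j then 2 ^ Fintype.card ι else 0 := by
  have h := sum_signs_prod_pow (R := R)
    (fun l : ι => (if l = i then 1 else 0) + (if l = j then 1 else 0))
  simp only [pow_add, Finset.prod_mul_distrib, pow_ite, pow_one, pow_zero,
    Finset.prod_ite_eq', Finset.mem_univ, if_true] at h
  rw [h]
  by_cases hij : i = j
  · subst hij
    rw [if_pos, if_pos rfl]
    intro l
    split_ifs <;> decide
  · rw [if_neg, if_neg hij]
    intro hl
    have := hl i
    simp [hij] at this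

theorem norm_intCast_units {𝕜 : Type*} [RCLike 𝕜] (s : ℤˣ) : ‖((s : ℤ) : 𝕜)‖ = 1 := by
  rcases Int.units_eq_one_or s with rfl | rfl <;> simp

/-- Parseval for the orthogonal Rademacher functions; this is the `ℓ²` endpoint of the
interpolation. -/
theorem sum_signs_norm_sq {ι : Type*} [Fintype ι] [DecidableEq ι] (c : ι → ℂ) :
    ∑ ε : ι → ℤˣ, ‖∑ i, ((ε i : ℤ) : ℂ) * c i‖ ^ 2 =
      2 ^ Fintype.card ι * ∑ i, ‖c i‖ ^ 2 := by
  apply Complex.ofReal_injective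
  push_cast
  simp_rw [← Complex.mul_conj', map_sum, map_mul, Finset.sum_mul_sum]
  rw [Finset.sum_comm, Finset.mul_sum]
  refine Finset.sum_congr rfl fun i _ => ?_
  rw [Finset.sum_comm]
  have : ∀ j, ∑ ε : ι → ℤˣ, ((ε i : ℤ) : ℂ) * c i *
      ((starRingEnd ℂ) ((ε j : ℤ) : ℂ) * (starRingEnd ℂ) (c j)) =
      (if i = j then 2 ^ Fintype.card ι else 0) * (c i * (starRingEnd ℂ) (c j)) := by
    intro j
    rw [← sum_signs_mul, Finset.sum_mul]
    refine Finset.sum_congr rfl fun ε _ => ?_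
    rw [map_intCast]
    ring
  simp_rw [this]
  simp

/-- The interpolation argument behind the Riesz-Thorin theorem, for a finite matrix which is
bounded by `1` from `ℓ¹` to `ℓ^∞` and by `√N` on `ℓ²`. -/
theorem norm_sum_cpow_le_rpow {Ω ι : Type*} [Fintype Ω] [Fintype ι] (A : Ω → ι → ℂ) {N : ℝ}
    (hN : 0 ≤ N) (hA1 : ∀ ω i, ‖A ω i‖ ≤ 1)
    (hA2 : ∀ c : ι → ℂ, ∑ ω, ‖∑ i, A ω i * c i‖ ^ 2 ≤ N * ∑ i, ‖c i‖ ^ 2)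
    {u : ι → ℂ} {v : Ω → ℂ} (hu : ∀ i, ‖u i‖ ≤ 1) (hv : ∀ ω, ‖v ω‖ ≤ 1)
    {α : ι → ℝ} {β : Ω → ℝ} (hα : ∀ i, 0 ≤ α i) (hβ : ∀ ω, 0 ≤ β ω)
    (hα1 : ∑ i, α i ≤ 1) (hβ1 : ∑ ω, β ω ≤ 1) {θ : ℝ} (hθ0 : 0 ≤ θ) (hθ1 : θ ≤ 1) :
    ‖∑ ω, (∑ i, A ω i * (u i * (α i : ℂ) ^ (1 - (θ : ℂ) / 2))) *
      (v ω * (β ω : ℂ) ^ (1 - (θ : ℂ) / 2))‖ ≤ N ^ (θ / 2) := by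
  -- At `z = θ` this is the sum to be bounded. On `Re z = 0` the moduli are at most `α` and `β`, so
  -- the `ℓ¹ → ℓ^∞` bound gives `1`; on `Re z = 1` they are at most `√α` and `√β`, and
  -- Cauchy–Schwarz with `hA2` gives `√N`.
  let F : ℂ → ℂ := fun z => ∑ ω, (∑ i, A ω i * (u i * (α i : ℂ) ^ (1 - z / 2))) *
      (v ω * (β ω : ℂ) ^ (1 - z / 2))
  -- Some `α i` or `β ω` may vanish, and `0 ^ w` is not continuous at `w = 0`.
  have hne : ∀ z : ℂ, z.re < 2 → 1 - z / 2 ≠ 0 := by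
    intro z hz h0
    have := congrArg Complex.re h0
    simp at this
    linarith
  have hre : ∀ z : ℂ, (1 - z / 2).re = 1 - z.re / 2 := by intro z; simp
  have hun : ∀ (z : ℂ) (i : ι), z.re < 2 →
      ‖u i * (α i : ℂ) ^ (1 - z / 2)‖ ≤ α i ^ (1 - z.re / 2) := by
    intro z i hz
    rw [norm_mul, norm_cpow_eq_rpow_re_of_nonneg (hα i) (by rw [hre]; linarith), hre]
    exact mul_le_of_le_one_left (Real.rpow_nonneg (hα i) _) (hu i)
  have hvn : ∀ (z : ℂ) (ω : Ω), z.re < 2 →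
      ‖v ω * (β ω : ℂ) ^ (1 - z / 2)‖ ≤ β ω ^ (1 - z.re / 2) := by
    intro z ω hz
    rw [norm_mul, norm_cpow_eq_rpow_re_of_nonneg (hβ ω) (by rw [hre]; linarith), hre]
    exact mul_le_of_le_one_left (Real.rpow_nonneg (hβ ω) _) (hv ω)
  have hFn : ∀ z : ℂ, z.re < 2 → ‖F z‖ ≤ ∑ ω, (∑ i, α i ^ (1 - z.re / 2)) *
      β ω ^ (1 - z.re / 2) := by
    intro z hz
    refine (norm_sum_le _ _).trans (Finset.sum_le_sum fun ω _ => ?_)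
    rw [norm_mul]
    refine mul_le_mul ((norm_sum_le _ _).trans (Finset.sum_le_sum fun i _ => ?_)) (hvn z ω hz)
      (norm_nonneg _) (Finset.sum_nonneg fun i _ => Real.rpow_nonneg (hα i) _)
    rw [norm_mul]
    exact (mul_le_of_le_one_left (norm_nonneg _) (hA1 ω i)).trans (hun z i hz)
  have hd : ∀ z : ℂ, z.re < 2 → DifferentiableAt ℂ F z := by
    intro z hz
    have hc : ∀ c : ℂ, DifferentiableAt ℂ (fun z : ℂ => c ^ (1 - z / 2)) z := by
      intro c
      refine DifferentiableAt.const_cpow (by fun_prop) (Or.inr (hne z hz))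
    refine DifferentiableAt.fun_sum fun ω _ => ?_
    refine DifferentiableAt.mul (DifferentiableAt.fun_sum fun i _ => ?_) ((hc _).const_mul _)
    exact ((hc _).const_mul _).const_mul _
  have hdiff : DiffContOnCl ℂ F (verticalStrip 0 1) := by
    refine DifferentiableOn.diffContOnCl fun z hz => (hd z ?_).differentiableWithinAt
    have : z ∈ re ⁻¹' (Set.Icc 0 1) := by
      rw [← closure_Ioo zero_ne_one, ← closure_preimage_re]
      exact hz
    have h2 : z.re ≤ 1 := this.2
    linarith
  have hα' : ∀ i, α i ≤ 1 := fun i =>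
    (Finset.single_le_sum (fun j _ => hα j) (Finset.mem_univ i)).trans hα1
  have hβ' : ∀ ω, β ω ≤ 1 := fun ω =>
    (Finset.single_le_sum (fun j _ => hβ j) (Finset.mem_univ ω)).trans hβ1
  have hB : BddAbove ((norm ∘ F) '' verticalClosedStrip 0 1) := by
    refine ⟨∑ _ω : Ω, (∑ _i : ι, (1 : ℝ)) * 1, ?_⟩
    rintro _ ⟨z, hz, rfl⟩
    have h1 : z.re ≤ 1 := hz.2
    refine (hFn z (by linarith)).trans (Finset.sum_le_sum fun ω _ => ?_)
    refine mul_le_mul (Finset.sum_le_sum fun i _ => ?_) ?_ (Real.rpow_nonneg (hβ ω) _)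
      (by positivity)
    · exact Real.rpow_le_one (hα i) (hα' i) (by linarith)
    · exact Real.rpow_le_one (hβ ω) (hβ' ω) (by linarith)
  have h0 : ∀ z ∈ re ⁻¹' {(0 : ℝ)}, ‖F z‖ ≤ 1 := by
    intro z hz
    have hz : z.re = 0 := hz
    refine (hFn z (by linarith)).trans ?_
    simp only [hz, zero_div, sub_zero, Real.rpow_one]
    rw [← Finset.mul_sum]
    exact mul_le_one₀ hα1 (Finset.sum_nonneg fun ω _ => hβ ω) hβ1
  have hsq : ∀ x : ℝ, 0 ≤ x → (x ^ (1 - (1 : ℝ) / 2)) ^ 2 = x := by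
    intro x hx
    rw [← Real.rpow_natCast, ← Real.rpow_mul hx]
    norm_num
  have h1 : ∀ z ∈ re ⁻¹' {(1 : ℝ)}, ‖F z‖ ≤ √N := by
    intro z hz
    have hz : z.re = 1 := hz
    have hz2 : z.re < 2 := by linarith
    apply Real.le_sqrt_of_sq_le
    have hcs : ‖F z‖ ≤ ∑ ω, ‖∑ i, A ω i * (u i * (α i : ℂ) ^ (1 - z / 2))‖ *
        ‖v ω * (β ω : ℂ) ^ (1 - z / 2)‖ :=
      (norm_sum_le _ _).trans (le_of_eq (Finset.sum_congr rfl fun ω _ => norm_mul _ _))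
    refine (pow_le_pow_left₀ (norm_nonneg _) hcs 2).trans ?_
    refine (Finset.sum_mul_sq_le_sq_mul_sq _ _ _).trans ?_
    have e1 : ∑ i, ‖u i * (α i : ℂ) ^ (1 - z / 2)‖ ^ 2 ≤ 1 := by
      refine (Finset.sum_le_sum fun i _ => ?_).trans hα1
      have := pow_le_pow_left₀ (norm_nonneg _) (hun z i hz2) 2
      rwa [hz, hsq _ (hα i)] at this
    have e2 : ∑ ω, ‖v ω * (β ω : ℂ) ^ (1 - z / 2)‖ ^ 2 ≤ 1 := by
      refine (Finset.sum_le_sum fun i _ => ?_).trans hβ1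
      have := pow_le_pow_left₀ (norm_nonneg _) (hvn z i hz2) 2
      rwa [hz, hsq _ (hβ i)] at this
    calc _ ≤ (N * 1) * 1 := mul_le_mul ((hA2 _).trans (mul_le_mul_of_nonneg_left e1 hN)) e2
            (Finset.sum_nonneg fun _ _ => by positivity) (by positivity)
      _ = N := by ring
  have hmem : (θ : ℂ) ∈ verticalClosedStrip 0 1 := by
    simp only [verticalClosedStrip, Set.mem_preimage, Complex.ofReal_re]
    exact ⟨hθ0, hθ1⟩
  have := norm_le_interp_of_mem_verticalClosedStrip₀₁' F hmem hdiff hB h0 h1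
  rw [Real.one_rpow, one_mul, Complex.ofReal_re, Real.sqrt_eq_rpow, ← Real.rpow_mul hN] at this
  rwa [show θ / 2 = 1 / 2 * θ by ring]

theorem exists_unit_mul_eq_norm (s : ℂ) : ∃ v : ℂ, ‖v‖ = 1 ∧ s * v = ‖s‖ := by
  by_cases hs : s = 0
  · exact ⟨1, by simp, by simp [hs]⟩
  · have hs' : (‖s‖ : ℂ) ≠ 0 := by simpa using hs
    refine ⟨(‖s‖ : ℂ) / s, ?_, ?_⟩
    · simp [hs]
    · field_simp

/-- A Hausdorff-Young inequality for finite matrices. -/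
theorem sum_norm_rpow_le {Ω ι : Type*} [Fintype Ω] [Fintype ι] (A : Ω → ι → ℂ) {N : ℝ}
    (hN : 0 ≤ N) (hA1 : ∀ ω i, ‖A ω i‖ ≤ 1)
    (hA2 : ∀ c : ι → ℂ, ∑ ω, ‖∑ i, A ω i * c i‖ ^ 2 ≤ N * ∑ i, ‖c i‖ ^ 2)
    {q p : ℝ} (hq : 2 ≤ q) (hpq : p.HolderConjugate q) (a : ι → ℂ) :
    ∑ ω, ‖∑ i, A ω i * a i‖ ^ q ≤ N * (∑ i, ‖a i‖ ^ p) ^ (q - 1) := by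
  have hp0 : 0 < p := hpq.pos
  have hq0 : 0 < q := by linarith
  set T := ∑ i, ‖a i‖ ^ p with hT
  set S : Ω → ℂ := fun ω => ∑ i, A ω i * a i with hS
  set R := ∑ ω, ‖S ω‖ ^ q with hR
  have hT0 : 0 ≤ T := Finset.sum_nonneg fun i _ => by positivity
  have hR0 : 0 ≤ R := Finset.sum_nonneg fun i _ => by positivity
  rcases hR0.eq_or_lt with hR' | hRpos
  · rw [← hR']; positivity
  have hTpos : 0 < T := by
    refine hT0.lt_of_ne fun h => ?_
    have ha : ∀ i, a i = 0 := by
      intro i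
      have := (Finset.sum_eq_zero_iff_of_nonneg (fun i _ => by positivity)).1 h.symm i
        (Finset.mem_univ i)
      rw [Real.rpow_eq_zero (norm_nonneg _) hp0.ne'] at this
      simpa using this
    rw [hR] at hRpos
    simp [hS, ha, hq0.ne'] at hRpos
  choose w hw1 hw2 using fun i => exists_unit_mul_eq_norm (a i)
  choose v hv1 hv2 using fun ω => exists_unit_mul_eq_norm (S ω)
  have hw2' : ∀ i, (w i)⁻¹ * ‖a i‖ = a i := by
    intro i
    have : w i ≠ 0 := fun h => by simpa [h] using hw1 i
    rw [← hw2]; field_simp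
  have hexp : 1 - 2 / q / 2 = 1 / p := by
    have h2 : 1 - 2 / q / 2 = 1 - q⁻¹ := by ring
    rw [h2, one_div]
    exact hpq.symm.one_sub_inv
  -- With `θ = 2/q` the exponent `1 - θ/2` is `1/p`. The `α`-vector is then `a` normalized in `ℓ^p`,
  -- and the `β`-vector is the normalized extremizer dual to `S`, so `key` reads `R^(1/q) / T^(1/p)
  -- ≤ N^(1/q)`.
  have key := norm_sum_cpow_le_rpow A hN hA1 hA2 (u := fun i => (w i)⁻¹) (v := v)
    (fun i => by rw [norm_inv, hw1]; simp) (fun ω => (hv1 ω).le)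
    (α := fun i => ‖a i‖ ^ p / T) (β := fun ω => ‖S ω‖ ^ q / R)
    (fun i => by positivity) (fun i => by positivity)
    (by rw [← Finset.sum_div]; exact (div_self hTpos.ne').le)
    (by rw [← Finset.sum_div]; exact (div_self hRpos.ne').le)
    (θ := 2 / q) (by positivity) ((div_le_one hq0).2 hq)
  have hcast : (1 : ℂ) - ((2 / q : ℝ) : ℂ) / 2 = ((1 / p : ℝ) : ℂ) := by
    rw [← hexp]; push_cast; ring
  have hα : ∀ i, (w i)⁻¹ * (((‖a i‖ ^ p / T : ℝ)) : ℂ) ^ ((1 / p : ℝ) : ℂ) =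
      a i * ((T ^ (1 / p))⁻¹ : ℝ) := by
    intro i
    rw [← Complex.ofReal_cpow (by positivity), Real.div_rpow (by positivity) hT0,
      ← Real.rpow_mul (norm_nonneg _), mul_one_div_cancel hp0.ne', Real.rpow_one,
      div_eq_mul_inv, Complex.ofReal_mul, ← mul_assoc, hw2']
  have hqp : q * (1 / p) = q - 1 := by
    rw [← hexp]; field_simp
  have hβ : ∀ ω, S ω * (v ω * (((‖S ω‖ ^ q / R : ℝ)) : ℂ) ^ ((1 / p : ℝ) : ℂ)) =
      ((‖S ω‖ ^ q * (R ^ (1 / p))⁻¹ : ℝ) : ℂ) := by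
    intro ω
    rw [← mul_assoc, hv2, ← Complex.ofReal_cpow (by positivity),
      Real.div_rpow (by positivity) hR0, ← Real.rpow_mul (norm_nonneg _), hqp,
      ← Complex.ofReal_mul]
    congr 1
    rw [div_eq_mul_inv, ← mul_assoc]
    congr 1
    nth_rewrite 1 [← Real.rpow_one ‖S ω‖]
    rw [← Real.rpow_add' (norm_nonneg _) (by linarith)]
    congr 1; ring
  simp only [hcast, hα] at key
  have hfac : ∀ ω, (∑ i, A ω i * (a i * ((T ^ (1 / p))⁻¹ : ℝ))) *
      (v ω * (((‖S ω‖ ^ q / R : ℝ)) : ℂ) ^ ((1 / p : ℝ) : ℂ)) =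
      ((‖S ω‖ ^ q * ((R ^ (1 / p))⁻¹ * (T ^ (1 / p))⁻¹) : ℝ) : ℂ) := by
    intro ω
    have : ∑ i, A ω i * (a i * ((T ^ (1 / p))⁻¹ : ℝ)) = S ω * ((T ^ (1 / p))⁻¹ : ℝ) := by
      rw [hS, Finset.sum_mul]
      exact Finset.sum_congr rfl fun i _ => by ring
    rw [this, mul_right_comm, hβ, ← Complex.ofReal_mul]
    congr 1; ring
  simp only [hfac] at key
  rw [← Complex.ofReal_sum, Complex.norm_real, ← Finset.sum_mul, ← hR,
    Real.norm_of_nonneg (by positivity)] at key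
  have hRq : R * (R ^ (1 / p))⁻¹ = R ^ (1 / q) := by
    nth_rewrite 1 [← Real.rpow_one R]
    rw [← Real.rpow_neg hR0, ← Real.rpow_add hRpos]
    congr 1
    rw [← hexp]; ring
  have hqq : 2 / q / 2 = 1 / q := by ring
  rw [← mul_assoc, hRq, hqq, ← div_eq_mul_inv, div_le_iff₀ (by positivity)] at key
  have := Real.rpow_le_rpow (by positivity) key hq0.le
  rwa [Real.mul_rpow (by positivity) (by positivity), ← Real.rpow_mul hR0, ← Real.rpow_mul hN,
    ← Real.rpow_mul hT0, one_div_mul_cancel hq0.ne', Real.rpow_one, Real.rpow_one, mul_comm (1 / p),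
    hqp] at this

/-- Hausdorff–Young for the sign matrix. The scalars are mapped isometrically into `ℂ`, which covers
the real case. -/
theorem sum_signs_norm_rpow_le {𝕜 ι : Type*} [RCLike 𝕜] [Fintype ι] [DecidableEq ι]
    {q p : ℝ} (hq : 2 ≤ q) (hpq : p.HolderConjugate q) (a : ι → 𝕜) :
    ∑ ε : ι → ℤˣ, ‖∑ i, ((ε i : ℤ) : 𝕜) * a i‖ ^ q ≤
      2 ^ Fintype.card ι * (∑ i, ‖a i‖ ^ p) ^ (q - 1) := by
  have hmap : ∀ z : 𝕜, ‖RCLike.map 𝕜 ℂ z‖ = ‖z‖ := by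
    intro z
    rw [← sq_eq_sq₀ (norm_nonneg _) (norm_nonneg _), RCLike.norm_sq_eq_def, RCLike.norm_sq_eq_def]
    simp [RCLike.map_apply]
  have hsum : ∀ ε : ι → ℤˣ, RCLike.map 𝕜 ℂ (∑ i, ((ε i : ℤ) : 𝕜) * a i) =
      ∑ i, ((ε i : ℤ) : ℂ) * RCLike.map 𝕜 ℂ (a i) := by
    intro ε
    rw [map_sum]
    refine Finset.sum_congr rfl fun i _ => ?_
    rw [← zsmul_eq_mul, map_zsmul, zsmul_eq_mul]
  have := sum_norm_rpow_le (fun (ε : ι → ℤˣ) i => ((ε i : ℤ) : ℂ)) (N := 2 ^ Fintype.card ι)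
    (by positivity) (fun ε i => (norm_intCast_units _).le)
    (fun c => (sum_signs_norm_sq c).le) hq hpq (fun i => RCLike.map 𝕜 ℂ (a i))
  simpa only [← hsum, hmap] using this

end Scalar

/-! ### From Rademacher moments to polarization constants. -/

section Polarize

variable {𝕜 : Type*} [RCLike 𝕜] {E : Type*} [NormedAddCommGroup E] [NormedSpace 𝕜 E] {m : ℕ}

/-- The Rademacher polarization formula. -/
theorem IsSymmetricForm.sum_signs_apply
    {L : ContinuousMultilinearMap 𝕜 (fun _ : Fin m => E) 𝕜} (hL : IsSymmetricForm L)
    (x : Fin m → E) :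
    ∑ ε : Fin m → ℤˣ, (∏ i, ((ε i : ℤ) : 𝕜)) * L (fun _ => ∑ i, ((ε i : ℤ) : 𝕜) • x i) =
      2 ^ m * (m ! : 𝕜) * L x := by
  have h1 : ∀ ε : Fin m → ℤˣ, L (fun _ => ∑ i, ((ε i : ℤ) : 𝕜) • x i) =
      ∑ r : Fin m → Fin m, (∏ i, ((ε (r i) : ℤ) : 𝕜)) * L (fun i => x (r i)) := by
    intro ε
    rw [ContinuousMultilinearMap.map_sum]
    refine Finset.sum_congr rfl fun r _ => ?_
    rw [ContinuousMultilinearMap.map_smul_univ, smul_eq_mul]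
  -- Each `ε l` occurs once plus once for every element of the fibre of `r` over `l`. A nonzero sum
  -- forces all fibres to be odd, hence nonempty, so `r` is surjective and therefore bijective.
  have h2 : ∀ r : Fin m → Fin m, ∑ ε : Fin m → ℤˣ, (∏ i, ((ε i : ℤ) : 𝕜)) *
      ∏ i, ((ε (r i) : ℤ) : 𝕜) = if Function.Bijective r then 2 ^ m else 0 := by
    intro r
    have := sum_signs_prod_pow (R := 𝕜) (fun l => 1 + (Finset.univ.filter fun i => r i = l).card)
    simp only [pow_add, pow_one, Finset.prod_mul_distrib, Fintype.card_fin] at this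
    have e : ∀ ε : Fin m → ℤˣ, ∏ i, ((ε (r i) : ℤ) : 𝕜) =
        ∏ l, ((ε l : ℤ) : 𝕜) ^ (Finset.univ.filter fun i => r i = l).card := by
      intro ε
      rw [← Finset.prod_fiberwise Finset.univ r]
      refine Finset.prod_congr rfl fun l _ => ?_
      rw [Finset.prod_congr rfl (g := fun _ => ((ε l : ℤ) : 𝕜)), Finset.prod_const]
      intro i hi
      rw [(Finset.mem_filter.1 hi).2]
    simp_rw [e, this]
    refine if_congr ⟨fun h => ?_, fun h l => ?_⟩ rfl rfl
    · refine Finite.injective_iff_bijective.1 (Finite.injective_iff_surjective.2 fun l => ?_)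
      have hl := h l
      by_contra hne
      push Not at hne
      rw [Finset.filter_false_of_mem (fun i _ => hne i)] at hl
      simp at hl
    · obtain ⟨i, rfl⟩ := h.2 l
      have : (Finset.univ.filter fun j => r j = r i) = {i} := by
        ext j; simp [h.1.eq_iff]
      rw [this, Finset.card_singleton]
      decide
  simp_rw [h1, Finset.mul_sum]
  rw [Finset.sum_comm]
  have h3 : ∀ r : Fin m → Fin m, ∑ ε : Fin m → ℤˣ, (∏ i, ((ε i : ℤ) : 𝕜)) *
      ((∏ i, ((ε (r i) : ℤ) : 𝕜)) * L (fun i => x (r i))) =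
      if Function.Bijective r then 2 ^ m * L x else 0 := by
    intro r
    simp_rw [← mul_assoc]
    rw [← Finset.sum_mul, h2]
    split_ifs with hr
    · rw [← hL (Equiv.ofBijective r hr) x]
      rfl
    · simp
  simp_rw [h3]
  rw [← Finset.sum_filter, Finset.sum_const, nsmul_eq_mul]
  have hcard : (Finset.univ.filter fun r : Fin m → Fin m => Function.Bijective r).card = m ! := by
    rw [← Fintype.card_subtype, ← Fintype.card_congr (Equiv.ofBijective
      (fun σ : Equiv.Perm (Fin m) => (⟨σ, σ.bijective⟩ : {r : Fin m → Fin m // Function.Bijective r}))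
      ⟨fun σ τ h => by ext i; exact congrArg Fin.val (congrFun (congrArg Subtype.val h) i),
        fun r => ⟨Equiv.ofBijective r.1 r.2, rfl⟩⟩), Fintype.card_perm, Fintype.card_fin]
  rw [hcard]
  ring

theorem polyNorm_nonneg (L : ContinuousMultilinearMap 𝕜 (fun _ : Fin m => E) 𝕜) :
    0 ≤ polyNorm L :=
  Real.sSup_nonneg fun _ ⟨_, _, hr⟩ => hr ▸ norm_nonneg _

theorem norm_apply_le_polyNorm_mul (L : ContinuousMultilinearMap 𝕜 (fun _ : Fin m => E) 𝕜)
    (x : E) : ‖L (fun _ => x)‖ ≤ polyNorm L * ‖x‖ ^ m := by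
  by_cases hx : x = 0
  · subst hx
    rcases Nat.eq_zero_or_pos m with rfl | hm
    · rw [pow_zero, mul_one]
      exact le_csSup (bddAbove_polyNorm L) ⟨0, by simp, rfl⟩
    · have : L (fun _ => (0 : E)) = 0 := L.map_coord_zero ⟨0, hm⟩ rfl
      rw [this, norm_zero]
      exact mul_nonneg (polyNorm_nonneg L) (by positivity)
  · have hn : (0 : ℝ) < ‖x‖ := norm_pos_iff.2 hx
    have hu : ‖((‖x‖⁻¹ : ℝ) : 𝕜) • x‖ = 1 := by
      rw [norm_smul, RCLike.norm_ofReal, abs_of_pos (by positivity), inv_mul_cancel₀ hn.ne']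
    have h := le_csSup (bddAbove_polyNorm L)
      (show ‖L (fun _ => ((‖x‖⁻¹ : ℝ) : 𝕜) • x)‖ ∈ _ from ⟨_, hu.le, rfl⟩)
    rw [L.map_smul_univ (fun _ => ((‖x‖⁻¹ : ℝ) : 𝕜)) (fun _ => x), norm_smul] at h
    simp only [Finset.prod_const, Finset.card_univ, Fintype.card_fin, norm_pow,
      RCLike.norm_ofReal, abs_of_pos (inv_pos.2 hn)] at h
    rw [inv_pow, inv_mul_le_iff₀ (by positivity), mul_comm] at h
    exact h

/-- A bound for the `m`-th moments of Rademacher sums bounds the polarization constant. -/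
theorem polarizationConstant_le_of_sum_signs {K : ℝ} (hK : 0 < K)
    (h : ∀ x : Fin m → E, (∀ i, ‖x i‖ ≤ 1) →
      ∑ ε : Fin m → ℤˣ, ‖∑ i, ((ε i : ℤ) : 𝕜) • x i‖ ^ m ≤ 2 ^ m * K) :
    polarizationConstant 𝕜 m E ≤ ENNReal.ofReal (K / m !) := by
  have hf : (0 : ℝ) < m ! := by positivity
  have hM : 0 < (K / m !).toNNReal := by simpa using by positivity
  refine iInf₂_le_of_le _ hM (iInf_le_of_le ?_ le_rfl)
  intro L hL
  rw [Real.coe_toNNReal _ (by positivity)]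
  have hunit : ∀ x : Fin m → E, (∀ i, ‖x i‖ ≤ 1) → ‖L x‖ ≤ K / m ! * polyNorm L := by
    intro x hx
    have h1 := congrArg norm (hL.sum_signs_apply x)
    rw [norm_mul, norm_mul, norm_pow, RCLike.norm_ofNat, RCLike.norm_natCast] at h1
    have h2 : ‖∑ ε : Fin m → ℤˣ, (∏ i, ((ε i : ℤ) : 𝕜)) *
        L (fun _ => ∑ i, ((ε i : ℤ) : 𝕜) • x i)‖ ≤ polyNorm L * (2 ^ m * K) := by
      refine (norm_sum_le _ _).trans ?_
      refine le_trans (Finset.sum_le_sum fun ε _ => ?_)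
        ((Finset.mul_sum _ _ _).symm.le.trans
          (mul_le_mul_of_nonneg_left (h x hx) (polyNorm_nonneg L)))
      rw [norm_mul, norm_prod]
      simp only [norm_intCast_units, Finset.prod_const_one, one_mul]
      exact norm_apply_le_polyNorm_mul L _
    rw [h1] at h2
    have h3 : (0 : ℝ) < 2 ^ m := by positivity
    have h4 : (m ! : ℝ) * ‖L x‖ ≤ polyNorm L * K := by
      refine le_of_mul_le_mul_left ?_ h3
      linarith
    rw [div_mul_eq_mul_div, le_div_iff₀ hf]
    linarith
  refine L.opNorm_le_bound (mul_nonneg (by positivity) (polyNorm_nonneg L)) fun x => ?_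
  by_cases hx : ∃ i, x i = 0
  · obtain ⟨i, hi⟩ := hx
    rw [L.map_coord_zero i hi, norm_zero]
    exact mul_nonneg (mul_nonneg (by positivity) (polyNorm_nonneg L))
      (Finset.prod_nonneg fun _ _ => norm_nonneg _)
  · push Not at hx
    have hn : ∀ i, 0 < ‖x i‖ := fun i => norm_pos_iff.2 (hx i)
    have hu := hunit (fun i => ((‖x i‖⁻¹ : ℝ) : 𝕜) • x i) (fun i => by
      rw [norm_smul, RCLike.norm_ofReal, abs_of_pos (inv_pos.2 (hn i)),
        inv_mul_cancel₀ (hn i).ne'])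
    rw [L.map_smul_univ, norm_smul, norm_prod] at hu
    have : ∀ i, ‖((‖x i‖⁻¹ : ℝ) : 𝕜)‖ = ‖x i‖⁻¹ := fun i => by
      rw [RCLike.norm_ofReal, abs_of_pos (inv_pos.2 (hn i))]
    simp only [this] at hu
    rw [Finset.prod_inv_distrib,
      inv_mul_le_iff₀ (Finset.prod_pos fun i _ => hn i), mul_comm] at hu
    exact hu

theorem norm_sum_signs_smul_le (x : Fin m → E) (hx : ∀ i, ‖x i‖ ≤ 1) (ε : Fin m → ℤˣ) :
    ‖∑ i, ((ε i : ℤ) : 𝕜) • x i‖ ≤ m := by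
  refine (norm_sum_le _ _).trans ((Finset.sum_le_sum fun i _ => ?_).trans
    (by simp : ∑ _i : Fin m, (1 : ℝ) ≤ m))
  rw [norm_smul, norm_intCast_units, one_mul]
  exact hx i

/-- The classical polarization estimate. -/
theorem polarizationConstant_le_pow_self_div (hm : m ≠ 0) :
    polarizationConstant 𝕜 m E ≤ ENNReal.ofReal ((m : ℝ) ^ m / m !) := by
  refine polarizationConstant_le_of_sum_signs (by positivity) fun x hx => ?_
  refine (Finset.sum_le_sum fun ε _ =>
    pow_le_pow_left₀ (norm_nonneg _) (norm_sum_signs_smul_le x hx ε) m).trans ?_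
  simp

/-- A bound for the `q`-th moments of Rademacher sums, `q ≥ m`, bounds the polarization
constant. -/
theorem polarizationConstant_le_of_sum_signs_rpow {q B : ℝ} (hm : m ≠ 0) (hmq : m ≤ q)
    (hB : 0 < B)
    (h : ∀ x : Fin m → E, (∀ i, ‖x i‖ ≤ 1) →
      ∑ ε : Fin m → ℤˣ, ‖∑ i, ((ε i : ℤ) : 𝕜) • x i‖ ^ q ≤ 2 ^ m * B) :
    polarizationConstant 𝕜 m E ≤ ENNReal.ofReal (B ^ (m / q) / m !) := by
  have hm0 : (0 : ℝ) < m := by exact_mod_cast Nat.pos_of_ne_zero hm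
  have hq0 : 0 < q := hm0.trans_le hmq
  refine polarizationConstant_le_of_sum_signs (by positivity) fun x hx => ?_
  have h2 : (0 : ℝ) < 2 ^ m := by positivity
  -- Jensen for the uniform probability on signs, with exponent `q / m ≥ 1`.
  have := Real.arith_mean_le_rpow_mean Finset.univ (fun _ : Fin m → ℤˣ => ((2 : ℝ) ^ m)⁻¹)
    (fun ε => ‖∑ i, ((ε i : ℤ) : 𝕜) • x i‖ ^ m) (fun _ _ => by positivity) (by simp)
    (fun _ _ => by positivity) ((one_le_div hm0).2 hmq)
  simp_rw [← Finset.mul_sum] at this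
  rw [inv_mul_le_iff₀ h2] at this
  refine this.trans (mul_le_mul_of_nonneg_left ?_ h2.le)
  rw [one_div_div]
  refine Real.rpow_le_rpow (by positivity) ?_ (by positivity)
  rw [inv_mul_le_iff₀ h2]
  refine (Finset.sum_congr rfl fun ε _ => ?_).trans_le (h x hx)
  rw [← Real.rpow_natCast, ← Real.rpow_mul (norm_nonneg _), mul_div_cancel₀ _ hm0.ne']

end Polarize

/-! ### Rademacher moments in `L_p`. -/

section Moments

/-- Minkowski's integral inequality for the `ℓ^s`-norm of finitely many integrals. -/
theorem sum_lintegral_rpow_le {α κ : Type*} [Fintype κ] [MeasurableSpace α] {μ : Measure α}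
    (f : κ → α → ℝ≥0∞) (hf : ∀ k, AEMeasurable (f k) μ) (hfin : ∀ k, ∫⁻ a, f k a ∂μ ≠ ∞)
    {s : ℝ} (hs : 1 ≤ s) :
    (∑ k, (∫⁻ a, f k a ∂μ) ^ s) ^ (1 / s) ≤ ∫⁻ a, (∑ k, f k a ^ s) ^ (1 / s) ∂μ := by
  rcases hs.eq_or_lt with rfl | hs
  · simp only [ENNReal.rpow_one, div_one]
    rw [lintegral_finsetSum' _ fun k _ => hf k]
  have hs0 : 0 < s := by linarith
  set I : κ → ℝ≥0∞ := fun k => ∫⁻ a, f k a ∂μ with hI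
  set T := ∑ k, I k ^ s with hT
  have hc : s.HolderConjugate (Real.conjExponent s) := Real.HolderConjugate.conjExponent hs
  set t := Real.conjExponent s with ht
  have ht0 : 0 < t := hc.symm.pos
  have hst : 1 / s + 1 / t = 1 := by rw [one_div, one_div]; exact hc.inv_add_inv_eq_one
  have hTfin : T ≠ ∞ :=
    ENNReal.sum_ne_top.2 fun k _ => ENNReal.rpow_ne_top_of_nonneg hs0.le (hfin k)
  by_cases hT0 : T = 0
  · rw [hT0, ENNReal.zero_rpow_of_pos (by positivity)]
    exact zero_le
  have h1 : T = ∫⁻ a, ∑ k, I k ^ (s - 1) * f k a ∂μ := by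
    rw [lintegral_finsetSum' _ fun k _ => (hf k).const_mul _]
    refine Finset.sum_congr rfl fun k _ => ?_
    rw [lintegral_const_mul'' _ (hf k)]
    change I k ^ s = I k ^ (s - 1) * I k
    nth_rewrite 3 [← ENNReal.rpow_one (I k)]
    rw [← ENNReal.rpow_add_of_nonneg _ _ (by linarith) zero_le_one, sub_add_cancel]
  -- Hölder over `k` at each point; since `(s - 1) t = s`, the first factor is the constant `T ^ (1
  -- / t)`, which is cancelled at the end because `T` is finite and nonzero.
  have h2 : T ≤ T ^ (1 / t) * ∫⁻ a, (∑ k, f k a ^ s) ^ (1 / s) ∂μ := by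
    rw [← lintegral_const_mul' _ _ (ENNReal.rpow_ne_top_of_nonneg (by positivity) hTfin)]
    nth_rewrite 1 [h1]
    refine lintegral_mono fun a => ?_
    refine (ENNReal.inner_le_Lp_mul_Lq Finset.univ _ _ hc.symm).trans (le_of_eq ?_)
    congr 2
    refine Finset.sum_congr rfl fun k _ => ?_
    rw [← ENNReal.rpow_mul, hc.sub_one_mul_conj]
  have h3 : T = T ^ (1 / t) * T ^ (1 / s) := by
    rw [← ENNReal.rpow_add_of_nonneg _ _ (by positivity) (by positivity), add_comm, hst,
      ENNReal.rpow_one]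
  nth_rewrite 1 [h3] at h2
  refine (ENNReal.mul_le_mul_iff_right ?_ ?_).1 h2
  · exact (ENNReal.rpow_pos (pos_iff_ne_zero.2 hT0) hTfin).ne'
  · exact ENNReal.rpow_ne_top_of_nonneg (by positivity) hTfin

theorem sum_signs_enorm_rpow_le {𝕜 ι : Type*} [RCLike 𝕜] [Fintype ι] [DecidableEq ι]
    {q r : ℝ} (hq : 2 ≤ q) (hrq : r.HolderConjugate q) (a : ι → 𝕜) :
    ∑ ε : ι → ℤˣ, ‖∑ i, ((ε i : ℤ) : 𝕜) * a i‖ₑ ^ q ≤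
      2 ^ Fintype.card ι * (∑ i, ‖a i‖ₑ ^ r) ^ (q - 1) := by
  have h := ENNReal.ofReal_le_ofReal (sum_signs_norm_rpow_le hq hrq a)
  have e : ∀ (x : 𝕜) {t : ℝ}, 0 < t → ENNReal.ofReal (‖x‖ ^ t) = ‖x‖ₑ ^ t := by
    intro x t ht
    rw [← ofReal_norm, ENNReal.ofReal_rpow_of_nonneg (norm_nonneg _) ht.le]
  rw [ENNReal.ofReal_mul (by positivity), ENNReal.ofReal_sum_of_nonneg (fun _ _ => by positivity),
    ← ENNReal.ofReal_rpow_of_nonneg (by positivity) (by linarith),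
    ENNReal.ofReal_sum_of_nonneg (fun _ _ => by positivity), ENNReal.ofReal_pow (by norm_num)] at h
  simpa only [e _ (show 0 < q by linarith), e _ hrq.pos, ENNReal.ofReal_ofNat] using h

variable {𝕜 : Type*} [RCLike 𝕜] {Ω : Type*} [MeasurableSpace Ω] {μ : Measure Ω} {p : ℝ≥0∞}

theorem enorm_Lp_rpow (hp0 : p ≠ 0) (hp : p ≠ ∞) (f : Lp 𝕜 p μ) :
    ‖f‖ₑ ^ p.toReal = ∫⁻ a, ‖f a‖ₑ ^ p.toReal ∂μ := by
  rw [Lp.enorm_def, eLpNorm_eq_lintegral_rpow_enorm_toReal hp0 hp, ← ENNReal.rpow_mul,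
    one_div_mul_cancel (ENNReal.toReal_pos hp0 hp).ne', ENNReal.rpow_one]

/-- Rademacher type inequality for `L_p`: the map `x ↦ ∑ εᵢ xᵢ` from `ℓ_r(L_p)` to `L_q(L_p)` is
bounded by `1` if `r = q'` and `r ≤ p ≤ q`; here only for vectors of the unit ball. -/
theorem sum_signs_norm_Lp_rpow_le [Fact (1 ≤ p)] {m : ℕ} {q r : ℝ} (hm : m ≠ 0) (hq : 2 ≤ q)
    (hrq : r.HolderConjugate q) (hp : p ≠ ∞) (hrp : r ≤ p.toReal) (hpq : p.toReal ≤ q)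
    (x : Fin m → Lp 𝕜 p μ) (hx : ∀ i, ‖x i‖ ≤ 1) :
    ∑ ε : Fin m → ℤˣ, ‖∑ i, ((ε i : ℤ) : 𝕜) • x i‖ ^ q ≤ 2 ^ m * (m : ℝ) ^ (q - 1) := by
  have hp1 : (1 : ℝ≥0∞) ≤ p := Fact.out
  have hp0 : p ≠ 0 := (zero_lt_one.trans_le hp1).ne'
  set P := p.toReal with hP
  have hP0 : 0 < P := ENNReal.toReal_pos hp0 hp
  have hq0 : 0 < q := by linarith
  have hr0 : 0 < r := hrq.pos
  set s := q / P with hs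
  have hs1 : 1 ≤ s := (one_le_div hP0).2 hpq
  have hs0 : 0 < s := by linarith
  have hqr : q - 1 = q / r := by
    have := hrq.symm.div_conj_eq_sub_one
    linarith
  have hPs : P * s = q := mul_div_cancel₀ _ hP0.ne'
  set S : (Fin m → ℤˣ) → Lp 𝕜 p μ := fun ε => ∑ i, ((ε i : ℤ) : 𝕜) • x i with hS
  have hSae : ∀ᵐ a ∂μ, ∀ ε, S ε a = ∑ i, ((ε i : ℤ) : 𝕜) * x i a := by
    rw [ae_all_iff]
    intro ε
    have h1 := Lp.coeFn_fun_finsetSum (p := p) (μ := μ) Finset.univ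
      fun i => ((ε i : ℤ) : 𝕜) • x i
    have h2 : ∀ᵐ a ∂μ, ∀ i, (((ε i : ℤ) : 𝕜) • x i : Lp 𝕜 p μ) a = ((ε i : ℤ) : 𝕜) * x i a :=
      ae_all_iff.2 fun i => Lp.coeFn_smul _ _
    filter_upwards [h1, h2] with a h1 h2
    rw [h1]
    exact Finset.sum_congr rfl fun i _ => h2 i
  have hxm : ∀ f : Lp 𝕜 p μ, AEMeasurable (fun a => ‖f a‖ₑ ^ P) μ := fun f =>
    (Lp.aestronglyMeasurable f).enorm.pow_const _
  -- As `q ≥ p`, Minkowski with exponent `s = q / P` moves the sum over signs inside the integral.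
  have hmink := sum_lintegral_rpow_le (μ := μ) (fun ε a => ‖S ε a‖ₑ ^ P)
    (fun ε => hxm _)
    (fun ε => by
      rw [← enorm_Lp_rpow hp0 hp]
      exact ENNReal.rpow_ne_top_of_nonneg hP0.le enorm_ne_top) hs1
  have hE : ∀ f : Lp 𝕜 p μ, ∫⁻ a, ‖f a‖ₑ ^ P ∂μ = ‖f‖ₑ ^ P :=
    fun f => (enorm_Lp_rpow hp0 hp f).symm
  simp_rw [hE, ← ENNReal.rpow_mul, hPs] at hmink
  -- Hausdorff–Young at the point `a`, then the power mean inequality from `ℓ_r` to `ℓ_P`, which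
  -- costs `m^(P/r - 1)`. Integration contributes one more factor `m`.
  have hpt : ∀ᵐ a ∂μ, (∑ ε, ‖S ε a‖ₑ ^ q) ^ (1 / s) ≤
      ((2 : ℝ≥0∞) ^ m) ^ (1 / s) * ((m : ℝ≥0∞) ^ (P / r - 1) * ∑ i, ‖x i a‖ₑ ^ P) := by
    filter_upwards [hSae] with a ha
    simp_rw [ha]
    refine (ENNReal.rpow_le_rpow (sum_signs_enorm_rpow_le hq hrq fun i => x i a)
      (by positivity)).trans ?_
    rw [ENNReal.mul_rpow_of_nonneg _ _ (by positivity), Fintype.card_fin, ← ENNReal.rpow_mul]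
    refine mul_le_mul_right ?_ _
    have e : (q - 1) * (1 / s) = P / r := by
      rw [hqr, hs]; field_simp
    rw [e]
    have := ENNReal.rpow_sum_le_const_mul_sum_rpow Finset.univ (fun i => ‖x i a‖ₑ ^ r)
      ((one_le_div hr0).2 hrp)
    simp_rw [← ENNReal.rpow_mul, mul_div_cancel₀ _ hr0.ne'] at this
    simpa using this
  have hint : ∑ i, ∫⁻ a, ‖x i a‖ₑ ^ P ∂μ ≤ m := by
    refine (Finset.sum_le_sum fun i _ => ?_).trans (by simp : ∑ _i : Fin m, (1 : ℝ≥0∞) ≤ m)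
    rw [← enorm_Lp_rpow hp0 hp]
    refine ENNReal.rpow_le_one ?_ hP0.le
    rw [← ofReal_norm]
    exact ENNReal.ofReal_le_one.2 (hx i)
  have hm1 : (m : ℝ≥0∞) ≠ 0 := by exact_mod_cast hm
  have hm2 : (m : ℝ≥0∞) ≠ ∞ := ENNReal.natCast_ne_top m
  have h1 : (∑ ε, ‖S ε‖ₑ ^ q) ^ (1 / s) ≤ ((2 : ℝ≥0∞) ^ m) ^ (1 / s) * (m : ℝ≥0∞) ^ (P / r) := by
    refine hmink.trans ((lintegral_mono_ae hpt).trans ?_)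
    rw [lintegral_const_mul' _ _ (ENNReal.rpow_ne_top_of_nonneg (by positivity) (by simp)),
      lintegral_const_mul' _ _ (ENNReal.rpow_ne_top_of_ne_zero hm1 hm2),
      lintegral_finsetSum' _ fun i _ => hxm _]
    refine mul_le_mul_right ((mul_le_mul_right hint _).trans (le_of_eq ?_)) _
    nth_rewrite 2 [← ENNReal.rpow_one (m : ℝ≥0∞)]
    rw [← ENNReal.rpow_add _ _ hm1 hm2, sub_add_cancel]
  have h2 := ENNReal.rpow_le_rpow h1 hs0.le
  have e2 : P / r * s = q - 1 := by rw [hqr, hs]; field_simp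
  rw [ENNReal.mul_rpow_of_nonneg _ _ hs0.le, ← ENNReal.rpow_mul, ← ENNReal.rpow_mul,
    ← ENNReal.rpow_mul, one_div_mul_cancel hs0.ne', ENNReal.rpow_one, ENNReal.rpow_one, e2] at h2
  rw [← ENNReal.ofReal_le_ofReal_iff (by positivity), ENNReal.ofReal_mul (by positivity),
    ENNReal.ofReal_sum_of_nonneg (fun _ _ => by positivity), ENNReal.ofReal_pow (by norm_num),
    ← ENNReal.ofReal_rpow_of_nonneg (by positivity) (by linarith), ENNReal.ofReal_natCast,
    ENNReal.ofReal_ofNat]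
  refine le_trans (le_of_eq (Finset.sum_congr rfl fun ε _ => ?_)) h2
  rw [← ofReal_norm, ENNReal.ofReal_rpow_of_nonneg (norm_nonneg _) hq0.le]

/-- The basic estimate for the polarization constants of `L_p`. -/
theorem polarizationConstant_Lp_le [Fact (1 ≤ p)] {m : ℕ} {q r : ℝ} (hm : m ≠ 0) (hq : 2 ≤ q)
    (hmq : m ≤ q) (hrq : r.HolderConjugate q) (hp : p ≠ ∞) (hrp : r ≤ p.toReal)
    (hpq : p.toReal ≤ q) :
    polarizationConstant 𝕜 m (Lp 𝕜 p μ) ≤ ENNReal.ofReal ((m : ℝ) ^ (m / r) / m !) := by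
  have hm0 : (0 : ℝ) < m := by exact_mod_cast Nat.pos_of_ne_zero hm
  have h := polarizationConstant_le_of_sum_signs_rpow (𝕜 := 𝕜) (E := Lp 𝕜 p μ) hm hmq
    (Real.rpow_pos_of_pos hm0 (q - 1))
    fun x hx => sum_signs_norm_Lp_rpow_le hm hq hrq hp hrp hpq x hx
  rw [← Real.rpow_mul hm0.le] at h
  have e : (q - 1) * (m / q) = m / r := by
    have h1 := hrq.symm.div_conj_eq_sub_one
    have h2 := hrq.pos
    rw [← h1]
    field_simp
  rwa [e] at h

end Moments

/-! ### The permanent on `ℓ_p^m` as extremal form. -/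

section LowerBound

/-- AM–GM for the numbers `y i ^ P`, with equality when all `y i = m^(-1/P)`. -/
theorem prod_mul_pow_le_one {m : ℕ} (hm : m ≠ 0) {P : ℝ} (hP : 0 < P) (y : Fin m → ℝ)
    (hy : ∀ i, 0 ≤ y i) (h : ∑ i, y i ^ P ≤ 1) : (∏ i, y i) * (m : ℝ) ^ (m / P) ≤ 1 := by
  have hm0 : (0 : ℝ) < m := by exact_mod_cast Nat.pos_of_ne_zero hm
  have h1 := Real.geom_mean_le_arith_mean_weighted Finset.univ (fun _ : Fin m => (m : ℝ)⁻¹)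
    (fun i => y i ^ P) (fun _ _ => by positivity) (by simp [hm]) (fun i _ => by
      have := hy i
      positivity)
  rw [← Finset.mul_sum] at h1
  have h2 : ∏ i, (y i ^ P) ^ (m : ℝ)⁻¹ = (∏ i, y i) ^ (P / m) := by
    rw [← Real.finsetProd_rpow _ _ fun i _ => hy i]
    refine Finset.prod_congr rfl fun i _ => ?_
    rw [← Real.rpow_mul (hy i), div_eq_mul_inv]
  rw [h2] at h1
  have h3 : (∏ i, y i) ^ (P / m) ≤ (m : ℝ)⁻¹ :=
    h1.trans (mul_le_of_le_one_right (by positivity) h)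
  have hpr : 0 ≤ ∏ i, y i := Finset.prod_nonneg fun i _ => hy i
  have h4 := Real.rpow_le_rpow (by positivity) h3 (show 0 ≤ m / P by positivity)
  have e : P / m * (m / P) = 1 := by field_simp
  rw [← Real.rpow_mul hpr, e, Real.rpow_one, Real.inv_rpow hm0.le] at h4
  rwa [← le_div_iff₀ (by positivity), one_div]

variable {𝕜 : Type*} [RCLike 𝕜] {E : Type*} [NormedAddCommGroup E] [NormedSpace 𝕜 E] {m : ℕ}

/-- The permanent of the matrix `(c j (x i))`, as a continuous multilinear form in `x`. -/
noncomputable def permanentForm (c : Fin m → E →L[𝕜] 𝕜) :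
    ContinuousMultilinearMap 𝕜 (fun _ : Fin m => E) 𝕜 :=
  ∑ σ : Equiv.Perm (Fin m),
    (ContinuousMultilinearMap.mkPiAlgebra 𝕜 (Fin m) 𝕜).compContinuousLinearMap (fun i => c (σ i))

theorem permanentForm_apply (c : Fin m → E →L[𝕜] 𝕜) (x : Fin m → E) :
    permanentForm c x = ∑ σ : Equiv.Perm (Fin m), ∏ i, c (σ i) (x i) := by
  simp [permanentForm]

theorem isSymmetricForm_permanentForm (c : Fin m → E →L[𝕜] 𝕜) :
    IsSymmetricForm (permanentForm c) := by
  intro τ x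
  rw [permanentForm_apply, permanentForm_apply]
  refine Fintype.sum_equiv (Equiv.mulRight τ⁻¹) _ _ fun σ => ?_
  rw [← Equiv.prod_comp τ (fun i => c ((Equiv.mulRight τ⁻¹ σ) i) (x i))]
  simp

/-- If the closed unit ball of `E` looks like that of `ℓ_P^m`, then its polarization constant is
at least that of the permanent. -/
theorem le_polarizationConstant_of_coordinates (hm : m ≠ 0) {P : ℝ} (hP : 0 < P)
    (c : Fin m → E →L[𝕜] 𝕜) (e : Fin m → E) (he : ∀ i, ‖e i‖ ≤ 1)
    (hce : ∀ i j, c i (e j) = if i = j then 1 else 0)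
    (hc : ∀ x, ‖x‖ ≤ 1 → ∑ i, ‖c i x‖ ^ P ≤ 1) :
    ENNReal.ofReal ((m : ℝ) ^ (m / P) / m !) ≤ polarizationConstant 𝕜 m E := by
  have hm0 : (0 : ℝ) < m := by exact_mod_cast Nat.pos_of_ne_zero hm
  have hf : (0 : ℝ) < m ! := by positivity
  have hmp : (0 : ℝ) < (m : ℝ) ^ (m / P) := by positivity
  refine le_iInf fun M => le_iInf fun hM => le_iInf fun h => ?_
  have h1 := h _ (isSymmetricForm_permanentForm c)
  have h2 : permanentForm c e = 1 := by
    rw [permanentForm_apply, Finset.sum_eq_single 1]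
    · simp [hce]
    · intro σ _ hσ
      obtain ⟨i, hi⟩ : ∃ i, σ i ≠ i := by
        by_contra hne
        push Not at hne
        exact hσ (Equiv.ext hne)
      exact Finset.prod_eq_zero (Finset.mem_univ i) (by simp [hce, hi])
    · simp
  have h3 : 1 ≤ ‖permanentForm c‖ := by
    have := (permanentForm c).le_opNorm e
    rw [h2, norm_one] at this
    exact this.trans (mul_le_of_le_one_right (norm_nonneg _)
      (Finset.prod_le_one (fun _ _ => norm_nonneg _) fun i _ => he i))
  have h4 : polyNorm (permanentForm c) ≤ m ! / (m : ℝ) ^ (m / P) := by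
    refine csSup_le ⟨_, 0, by simp, rfl⟩ ?_
    rintro _ ⟨x, hx, rfl⟩
    -- On the diagonal all `m!` permutations contribute the same product.
    have : ∀ σ : Equiv.Perm (Fin m), ∏ i, c (σ i) x = ∏ i, c i x := fun σ =>
      Equiv.prod_comp σ fun i => c i x
    rw [permanentForm_apply]
    simp_rw [this]
    rw [Finset.sum_const, Finset.card_univ, Fintype.card_perm, Fintype.card_fin, nsmul_eq_mul,
      norm_mul, RCLike.norm_natCast, norm_prod, le_div_iff₀ hmp, mul_assoc]
    exact mul_le_of_le_one_right hf.le
      (prod_mul_pow_le_one hm hP _ (fun i => norm_nonneg _) (hc x hx))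
  have h5 : 1 ≤ (M : ℝ) * (m ! / (m : ℝ) ^ (m / P)) :=
    (h3.trans h1).trans (mul_le_mul_of_nonneg_left h4 M.2)
  rw [ENNReal.ofReal_le_iff_le_toReal ENNReal.coe_ne_top, ENNReal.coe_toReal, div_le_iff₀ hf]
  rwa [← mul_div_assoc, le_div_iff₀ hmp, one_mul] at h5

section Count

variable {Ω : Type*} [MeasurableSpace Ω] [MeasurableSingletonClass Ω] {p : ℝ≥0∞} [Fact (1 ≤ p)]

/-- Evaluation at a point, on `L_p` of the counting measure. -/
noncomputable def evalCount (𝕜 : Type*) [RCLike 𝕜] (p : ℝ≥0∞) [Fact (1 ≤ p)] (i : Ω) :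
    Lp 𝕜 p (Measure.count : Measure Ω) →L[𝕜] 𝕜 :=
  LinearMap.mkContinuous
    { toFun := fun f => f i
      map_add' := fun f g => Measure.ae_count_iff.1 (Lp.coeFn_add f g) i
      map_smul' := fun c f => Measure.ae_count_iff.1 (Lp.coeFn_smul c f) i } 1 fun f => by
    rw [one_mul, Lp.norm_def]
    have h := enorm_le_eLpNorm_count (f : Ω → 𝕜) i
      (zero_lt_one.trans_le (Fact.out : (1 : ℝ≥0∞) ≤ p)).ne'
    simpa using ENNReal.toReal_mono (Lp.eLpNorm_ne_top f) h

/-- This space is `ℓ_p^m`: point indicators are the unit vectors and evaluations the coordinates. -/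
theorem le_polarizationConstant_Lp_count (Ω : Type*) [Fintype Ω] [MeasurableSpace Ω]
    [MeasurableSingletonClass Ω] (hm : m ≠ 0) (hΩ : Fintype.card Ω = m) (hp : p ≠ ∞) :
    ENNReal.ofReal ((m : ℝ) ^ (m / p.toReal) / m !) ≤
      polarizationConstant 𝕜 m (Lp 𝕜 p (Measure.count : Measure Ω)) := by
  classical
  have hp0 : p ≠ 0 := (zero_lt_one.trans_le (Fact.out : (1 : ℝ≥0∞) ≤ p)).ne'
  have hP0 : 0 < p.toReal := ENNReal.toReal_pos hp0 hp
  let w : Fin m ≃ Ω := (Fintype.equivFinOfCardEq hΩ).symm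
  refine le_polarizationConstant_of_coordinates hm hP0 (fun i => evalCount 𝕜 p (w i))
    (fun i => indicatorConstLp p (measurableSet_singleton (w i)) (by simp) 1) ?_ ?_ ?_
  · intro i
    rw [norm_indicatorConstLp hp0 hp]
    simp [Measure.real]
  · intro i j
    have h : (evalCount 𝕜 p (w i))
        (indicatorConstLp p (measurableSet_singleton (w j)) (by simp) 1) =
        Set.indicator {w j} (fun _ => (1 : 𝕜)) (w i) :=
      Measure.ae_count_iff.1 (indicatorConstLp_coeFn (p := p) (μ := Measure.count)
        (hs := measurableSet_singleton (w j)) (hμs := by simp) (c := (1 : 𝕜))) (w i)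
    rw [h]
    simp [Set.indicator_apply]
  · intro f hf
    have h := enorm_Lp_rpow hp0 hp f
    rw [lintegral_count, tsum_fintype] at h
    have h1 : ‖f‖ₑ ^ p.toReal ≤ 1 := by
      refine ENNReal.rpow_le_one ?_ hP0.le
      rw [← ofReal_norm]
      exact ENNReal.ofReal_le_one.2 hf
    rw [h, ← Equiv.sum_comp w] at h1
    rw [← ENNReal.ofReal_le_ofReal_iff zero_le_one, ENNReal.ofReal_one,
      ENNReal.ofReal_sum_of_nonneg fun _ _ => by positivity]
    refine le_trans (le_of_eq (Finset.sum_congr rfl fun i _ => ?_)) h1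
    rw [← ofReal_norm, ENNReal.ofReal_rpow_of_nonneg (norm_nonneg _) hP0.le]
    rfl

end Count

end LowerBound

/-! ### Comparison with Harris's value. -/

theorem pow_self_lt_factorial_sq {m : ℕ} (hm : 3 ≤ m) : m ^ m < (m !) ^ 2 := by
  have h : (m !) ^ 2 = ∏ i ∈ Finset.range m, (i + 1) * (m - i) := by
    rw [Finset.prod_mul_distrib, Finset.prod_range_add_one_eq_factorial, sq]
    congr 1
    rw [← Finset.prod_range_reflect, ← Finset.prod_range_add_one_eq_factorial]
    refine Finset.prod_congr rfl fun i hi => ?_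
    have := Finset.mem_range.1 hi
    omega
  -- With `m = i + k + 1`, the product is `(i + 1)(k + 1) = m + i k`; it exceeds `m` at `i = 1`
  -- because `m ≥ 3`.
  have hle : ∀ i < m, m ≤ (i + 1) * (m - i) := by
    intro i hi
    obtain ⟨k, rfl⟩ := Nat.exists_eq_add_of_lt hi
    rw [show i + k + 1 - i = k + 1 by omega]
    nlinarith [Nat.zero_le (i * k)]
  rw [h]
  calc m ^ m = ∏ i ∈ Finset.range m, m := by simp
    _ < _ := by
      refine Finset.prod_lt_prod (fun i _ => by omega)
        (fun i hi => hle i (Finset.mem_range.1 hi)) ⟨1, by simp; omega, ?_⟩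
      omega

/-- The value of the polarization constant is below the one conjectured by Harris. -/
theorem rpow_div_factorial_lt {m : ℕ} (hm : 3 ≤ m) {P : ℝ} (hP1 : 1 < P) (hP2 : P ≤ 2) :
    (m : ℝ) ^ (m / P) / m ! < ((m : ℝ) ^ m / m !) ^ (|P - 2| / P) := by
  have hm0 : (0 : ℝ) < m := by exact_mod_cast (by omega : 0 < m)
  have hf : (0 : ℝ) < m ! := by positivity
  have hP0 : 0 < P := by linarith
  have hlt : (m : ℝ) * Real.log m < 2 * Real.log m ! := by
    have h := pow_self_lt_factorial_sq hm
    have h' : (m : ℝ) ^ m < (m ! : ℝ) ^ 2 := by exact_mod_cast h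
    have := Real.log_lt_log (by positivity) h'
    rwa [Real.log_pow, Real.log_pow, Nat.cast_ofNat] at this
  rw [← Real.log_lt_log_iff (by positivity) (by positivity),
    Real.log_div (by positivity) hf.ne', Real.log_rpow hm0, Real.log_rpow (by positivity),
    Real.log_div (by positivity) hf.ne', Real.log_pow, abs_of_nonpos (by linarith)]
  -- This is the difference of the logarithms of the two sides.
  have hpos : 0 < (1 - 1 / P) * (2 * Real.log m ! - m * Real.log m) := by
    refine mul_pos ?_ (by linarith)
    rw [sub_pos, div_lt_one hP0]
    exact hP1
  have e : -(P - 2) / P = 2 * (1 / P) - 1 := by field_simp; ring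
  have e2 : (m : ℝ) / P = m * (1 / P) := by ring
  rw [e, e2]
  nlinarith

/-! ### The three ranges of `p`. -/

section

variable (𝕜 : Type*) [RCLike 𝕜] {m : ℕ} {p : ℝ≥0∞} [Fact (1 ≤ p)]

theorem toReal_conjExponent_natCast (hm : 2 ≤ m) :
    ((m : ℝ≥0∞).conjExponent ≠ ∞) ∧ (m : ℝ≥0∞).conjExponent.toReal = m / (m - 1) := by
  have h1 : (m : ℝ≥0∞) = ((m : ℝ≥0) : ℝ≥0∞) := by simp
  have h2 : (1 : ℝ≥0) < m := by exact_mod_cast (by omega : 1 < m)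
  rw [h1, ← ENNReal.coe_conjExponent h2]
  refine ⟨ENNReal.coe_ne_top, ?_⟩
  rw [ENNReal.coe_toReal, NNReal.conjExponent, NNReal.coe_div, NNReal.coe_sub h2.le]
  simp

theorem natCast_holderConjugate (hm : 2 ≤ m) :
    ((m : ℝ) / (m - 1)).HolderConjugate m :=
  (Real.HolderConjugate.conjExponent (by exact_mod_cast (by omega : 1 < m))).symm

/-- Take `r = p` and `q = p'`: the condition `p ≤ m'` says that `q ≥ m`. -/
theorem polarizationConstantLp_le_of_le_conjExponent (hm : 2 ≤ m)
    (hp : p ≤ (m : ℝ≥0∞).conjExponent) :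
    polarizationConstantLp.{u} 𝕜 m p ≤ ENNReal.ofReal ((m : ℝ) ^ ((m : ℝ) / p.toReal) / m !) := by
  refine iSup_le fun Ω => iSup_le fun _ => iSup_le fun μ => ?_
  obtain ⟨hc1, hc2⟩ := toReal_conjExponent_natCast hm
  have hpt : p ≠ ∞ := ne_top_of_le_ne_top hc1 hp
  have hp1 : 1 ≤ p.toReal := by
    rw [← ENNReal.toReal_one]
    exact ENNReal.toReal_mono hpt Fact.out
  have hm2 : (2 : ℝ) ≤ m := by exact_mod_cast hm
  -- For `p = 1` the conjugate exponent is infinite, so the classical estimate is used instead.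
  rcases hp1.eq_or_lt with h1 | h1
  · rw [← h1, div_one, Real.rpow_natCast]
    exact polarizationConstant_le_pow_self_div (by omega)
  · have hpm : p.toReal ≤ m / (m - 1) := hc2 ▸ ENNReal.toReal_mono hc1 hp
    have hc := Real.HolderConjugate.conjExponent h1
    have hmq : (m : ℝ) ≤ p.toReal.conjExponent := by
      rw [Real.conjExponent, le_div_iff₀ (by linarith)]
      rw [le_div_iff₀ (by linarith)] at hpm
      linarith
    have hp2 : p.toReal ≤ 2 := hpm.trans (by
      rw [div_le_iff₀ (by linarith)]; linarith)
    exact polarizationConstant_Lp_le (by omega) (hm2.trans hmq) hmq hc hpt le_rfl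
      (by linarith)

/-- Take `q = m` and `r = m'`, so that `m / r = m - 1`. -/
theorem polarizationConstantLp_le_of_mem_Icc (hm : 2 ≤ m)
    (hp : (m : ℝ≥0∞).conjExponent ≤ p) (hp' : p ≤ m) :
    polarizationConstantLp.{u} 𝕜 m p ≤ ENNReal.ofReal ((m : ℝ) ^ (m - 1) / m !) := by
  refine iSup_le fun Ω => iSup_le fun _ => iSup_le fun μ => ?_
  obtain ⟨hc1, hc2⟩ := toReal_conjExponent_natCast hm
  have hpt : p ≠ ∞ := ne_top_of_le_ne_top (ENNReal.natCast_ne_top m) hp'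
  have hm2 : (2 : ℝ) ≤ m := by exact_mod_cast hm
  have h := polarizationConstant_Lp_le (𝕜 := 𝕜) (p := p) (μ := μ) (m := m) (by omega) hm2 le_rfl
    (natCast_holderConjugate hm) hpt (hc2 ▸ ENNReal.toReal_mono hpt hp)
    (by simpa using ENNReal.toReal_mono (ENNReal.natCast_ne_top m) hp')
  rwa [div_div_cancel₀ (by positivity), ← Nat.cast_pred (by omega), Real.rpow_natCast] at h

/-- Take `q = p` and `r = p'`; for `p = ∞` the classical estimate already has the right exponent. -/
theorem polarizationConstantLp_le_of_natCast_le (hm : 2 ≤ m) (hp : (m : ℝ≥0∞) ≤ p) :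
    polarizationConstantLp.{u} 𝕜 m p ≤
      ENNReal.ofReal ((m : ℝ) ^ ((m : ℝ) / p.conjExponent.toReal) / m !) := by
  refine iSup_le fun Ω => iSup_le fun _ => iSup_le fun μ => ?_
  have hm2 : (2 : ℝ) ≤ m := by exact_mod_cast hm
  by_cases hpt : p = ∞
  · subst hpt
    have hc : (∞ : ℝ≥0∞).conjExponent.toReal = 1 := by simp [ENNReal.conjExponent]
    rw [hc, div_one, Real.rpow_natCast]
    exact polarizationConstant_le_pow_self_div (by omega)
  · have hmp : (m : ℝ) ≤ p.toReal := by simpa using ENNReal.toReal_mono hpt hp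
    have h1 : 1 < p.toReal := by linarith
    have hc : p.conjExponent.toReal = p.toReal.conjExponent := by
      lift p to ℝ≥0 using hpt
      rw [ENNReal.coe_toReal] at h1
      have h1' : 1 < p := by exact_mod_cast h1
      rw [← ENNReal.coe_conjExponent h1', ENNReal.coe_toReal, ENNReal.coe_toReal,
        NNReal.conjExponent, NNReal.coe_div, NNReal.coe_sub h1'.le, Real.conjExponent,
        NNReal.coe_one]
    rw [hc]
    refine polarizationConstant_Lp_le (by omega) (hm2.trans hmp) hmp
      (Real.HolderConjugate.conjExponent h1).symm hpt ?_ le_rfl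
    rw [Real.conjExponent, div_le_iff₀ (by linarith)]
    nlinarith

theorem le_polarizationConstantLp (hm : m ≠ 0) (hp : p ≠ ∞) :
    ENNReal.ofReal ((m : ℝ) ^ ((m : ℝ) / p.toReal) / m !) ≤ polarizationConstantLp.{u} 𝕜 m p := by
  -- The `m`-point space is lifted to the universe over which the supremum runs.
  let _ : MeasurableSpace (ULift.{u} (Fin m)) := ⊤
  have : MeasurableSingletonClass (ULift.{u} (Fin m)) := ⟨fun _ => trivial⟩
  refine (le_polarizationConstant_Lp_count (𝕜 := 𝕜) (ULift.{u} (Fin m)) hm (by simp) hp).trans ?_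
  exact le_iSup_of_le (ULift.{u} (Fin m)) (le_iSup_of_le _ (le_iSup_of_le Measure.count le_rfl))

end

end Polarization

theorem proposition3p10 (𝕜 : Type*) [RCLike 𝕜] (m : ℕ) (hm : 2 ≤ m)
    (p : ℝ≥0∞) [Fact (1 ≤ p)] :
    (p ≤ (m : ℝ≥0∞).conjExponent →
      Polarization.polarizationConstantLp.{u} 𝕜 m p ≤
        ENNReal.ofReal ((m : ℝ) ^ ((m : ℝ) / p.toReal) / (m ! : ℝ))) ∧
    ((m : ℝ≥0∞).conjExponent ≤ p → p ≤ (m : ℝ≥0∞) →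
      Polarization.polarizationConstantLp.{u} 𝕜 m p ≤
        ENNReal.ofReal ((m : ℝ) ^ (m - 1) / (m ! : ℝ))) ∧
    ((m : ℝ≥0∞) ≤ p →
      Polarization.polarizationConstantLp.{u} 𝕜 m p ≤
        ENNReal.ofReal ((m : ℝ) ^ ((m : ℝ) / p.conjExponent.toReal) / (m ! : ℝ))) ∧
    (p ≤ (m : ℝ≥0∞).conjExponent →
      Polarization.polarizationConstantLp.{u} 𝕜 m p =
        ENNReal.ofReal ((m : ℝ) ^ ((m : ℝ) / p.toReal) / (m ! : ℝ))) ∧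
    (3 ≤ m → 1 < p → p ≤ (m : ℝ≥0∞).conjExponent →
      Polarization.polarizationConstantLp.{u} 𝕜 m p <
        ENNReal.ofReal (((m : ℝ) ^ m / (m ! : ℝ)) ^ (|p.toReal - 2| / p.toReal))) := by
  obtain ⟨hc1, hc2⟩ := Polarization.toReal_conjExponent_natCast hm
  refine ⟨Polarization.polarizationConstantLp_le_of_le_conjExponent 𝕜 hm,
    Polarization.polarizationConstantLp_le_of_mem_Icc 𝕜 hm,
    Polarization.polarizationConstantLp_le_of_natCast_le 𝕜 hm, fun hp => ?_, fun hm3 hp1 hp => ?_⟩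
  · exact le_antisymm (Polarization.polarizationConstantLp_le_of_le_conjExponent 𝕜 hm hp)
      (Polarization.le_polarizationConstantLp 𝕜 (by omega) (ne_top_of_le_ne_top hc1 hp))
  · refine (Polarization.polarizationConstantLp_le_of_le_conjExponent 𝕜 hm hp).trans_lt ?_
    have hm2 : (2 : ℝ) ≤ m := by exact_mod_cast hm
    have hpm : p.toReal ≤ m / (m - 1) := hc2 ▸ ENNReal.toReal_mono hc1 hp
    have hp2 : p.toReal ≤ 2 := hpm.trans (by
      rw [div_le_iff₀ (by linarith)]; linarith)
    have hp1' : 1 < p.toReal := by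
      rw [← ENNReal.toReal_one]
      exact (ENNReal.toReal_lt_toReal ENNReal.one_ne_top (ne_top_of_le_ne_top hc1 hp)).2 hp1
    have hlt := Polarization.rpow_div_factorial_lt hm3 hp1' hp2
    exact (ENNReal.ofReal_lt_ofReal_iff (lt_of_le_of_lt (by positivity) hlt)).2 hlt
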